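/- Let $S$ be a finitely generated monoid which is commutative or is an inverse semigroup (that is, for every $x\in S$ there is a unique $y\in S$ with $xyx=x$ and $yxy=y$). Let $T$ be a finite set generating $S$ as a monoid, and for $a\in S$ let $|a|$ be the least $k\ge 0$ such that $a$ is a product of $k$ elements of $T$. Let $R_n=X_1\cdots X_n$ ($n\ge 0$, $R_0=1$), where $X_1,X_2,\dots$ are i.i.d. random variables distributed uniformly on $T$, be the simple random walk on $S$ with respect to $T$. If $\sup_{n}\mathbb{E}|R_n|<\infty$, then $S$ contains a finite non-empty two-sided ideal, i.e. a finite non-empty set $I\subseteq S$ with $SI\subseteq I$ and $IS\subseteq I$. -/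

import Mathlib

open MeasureTheory ProbabilityTheory

/-- The word length of `a` with respect to `T`: the least `k` such that `a` is a product of `k`
elements of `T`, which is the distance from `1` to `a` in the right Cayley graph of `(S, T)`.
The set on the right is non-empty whenever `T` generates the monoid `S`. -/
noncomputable def wordLength {S : Type*} [Monoid S] (T : Set S) (a : S) : ℕ :=
  sInf {k : ℕ | ∃ l : List S, l.length = k ∧ (∀ t ∈ l, t ∈ T) ∧ l.prod = a}

/-- `R` is a simple (right) random walk on `S` with respect to the finite set `T`, started at `1`:
`R n = X 0 * X 1 * ⋯ * X (n - 1)`, where the steps `X i` are independent random variables, each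
uniformly distributed on `T`. -/
def IsSimpleRandomWalk {S : Type*} [Monoid S] [MeasurableSpace S] {Ω : Type*} [MeasurableSpace Ω]
    (T : Finset S) (R : ℕ → Ω → S) (μ : Measure Ω) : Prop :=
  ∃ X : ℕ → Ω → S,
    (∀ n, Measurable (X n)) ∧
    iIndepFun X μ ∧
    (∀ n, μ.map (X n) = uniformOn (T : Set S)) ∧
    ∀ n ω, R n ω = (List.ofFn fun i : Fin n => X i ω).prod

/-- An inverse semigroup: each `x` has exactly one weak inverse, i.e. exactly one `y` with
`x y x = x` and `y x y = y`. -/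
def IsInverseSemigroup (S : Type*) [Semigroup S] : Prop :=
  ∀ x : S, ∃! y : S, x * y * x = x ∧ y * x * y = y

/-- A (non-empty) two-sided ideal of a semigroup, as a set. -/
structure IsSemigroupIdeal {S : Type*} [Semigroup S] (I : Set S) : Prop where
  nonempty : I.Nonempty
  mul_mem_left : ∀ s : S, ∀ a ∈ I, s * a ∈ I
  mul_mem_right : ∀ s : S, ∀ a ∈ I, a * s ∈ I

/-! Bounded mean length and Markov's inequality keep probability at least 1/2 in a fixed ball, which
is finite. Cesàro averages of the laws, taken along an ultrafilter, give a finitely additive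
stationary `m` charging that ball, so some point has positive mass. Mass cannot accumulate in a
right ideal under a stationary `m`, so points of positive mass are right recurrent. Hence
`rightRecurrent S`, always closed under multiplication on both sides, is non-empty. The algebraic
hypothesis makes this ideal a single orbit on which right translations are injective. The maximum
principle then makes `z ↦ m {z}` a positive constant there, which forces finiteness. -/

/-! ### Algebra of the right recurrent elements -/

section Algebra

variable {S : Type*} [Monoid S]

/-- The elements to which one can always return by right multiplication. -/
def rightRecurrent (S : Type*) [Monoid S] : Set S :=
  {x | ∀ s : S, ∃ u : S, x * s * u = x}

theorem mul_mem_rightRecurrent_left (s : S) {x : S} (hx : x ∈ rightRecurrent S) :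
    s * x ∈ rightRecurrent S := by
  intro a
  obtain ⟨u, hu⟩ := hx a
  exact ⟨u, by rw [mul_assoc s x a, mul_assoc s, hu]⟩

theorem mul_mem_rightRecurrent_right (s : S) {x : S} (hx : x ∈ rightRecurrent S) :
    x * s ∈ rightRecurrent S := by
  intro a
  obtain ⟨u, hu⟩ := hx (s * a)
  exact ⟨u * s, by rw [← mul_assoc (x * s * a) u s, mul_assoc x s a, hu]⟩

/-- If `x` is the inverse of `e * f`, so is `f * x * e`; uniqueness makes `x` idempotent, hence its
own inverse, hence equal to `e * f`. -/
theorem IsInverseSemigroup.mul_mul_mul_self {S : Type*} [Semigroup S] (hS : IsInverseSemigroup S)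
    {e f : S} (he : e * e = e) (hf : f * f = f) : (e * f) * (e * f) = e * f := by
  obtain ⟨x, ⟨hx1, hx2⟩, hx⟩ := hS (e * f)
  have h1 : f * x * e = x := by
    refine hx _ ⟨?_, ?_⟩
    · calc e * f * (f * x * e) * (e * f) = e * (f * f) * x * (e * e) * f := by
            simp only [mul_assoc]
        _ = e * f * x * (e * f) := by rw [he, hf]; simp only [mul_assoc]
        _ = e * f := hx1
    · calc f * x * e * (e * f) * (f * x * e) = f * x * (e * e) * (f * f) * x * e := by
            simp only [mul_assoc]
        _ = f * (x * (e * f) * x) * e := by rw [he, hf]; simp only [mul_assoc]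
        _ = f * x * e := by rw [hx2]
  have h2 : x * x = x := by
    calc x * x = f * x * e * (f * x * e) := by rw [h1]
      _ = f * (x * (e * f) * x) * e := by simp only [mul_assoc]
      _ = x := by rw [hx2, h1]
  have h3 : e * f = x := (hS x).unique ⟨hx2, hx1⟩ ⟨by rw [h2, h2], by rw [h2, h2]⟩
  rw [h3, h2]

theorem IsInverseSemigroup.idempotents_commute {S : Type*} [Semigroup S]
    (hS : IsInverseSemigroup S) {e f : S} (he : e * e = e) (hf : f * f = f) :
    e * f = f * e := by
  have h1 := hS.mul_mul_mul_self he hf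
  have h2 := hS.mul_mul_mul_self hf he
  refine (hS (e * f)).unique ⟨by rw [h1, h1], by rw [h1, h1]⟩ ⟨?_, ?_⟩
  · calc e * f * (f * e) * (e * f) = e * (f * f) * (e * e) * f := by simp only [mul_assoc]
      _ = e * f := by rw [he, hf, mul_assoc (e * f), h1]
  · calc f * e * (e * f) * (f * e) = f * (e * e) * (f * f) * e := by simp only [mul_assoc]
      _ = f * e := by rw [he, hf, mul_assoc (f * e), h2]

theorem IsInverseSemigroup.eq_of_idempotent_mem_rightRecurrent (hS : IsInverseSemigroup S)
    {e f : S} (he : e * e = e) (hf : f * f = f) (heJ : e ∈ rightRecurrent S)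
    (hfJ : f ∈ rightRecurrent S) : e = f := by
  have key : ∀ {e f : S}, e * e = e → f * f = f → e ∈ rightRecurrent S → f * e = e := by
    intro e f he hf heJ
    obtain ⟨u, hu⟩ := heJ f
    calc f * e = f * (e * f * u) := by rw [hu]
      _ = (f * f) * e * u := by rw [hS.idempotents_commute he hf]; simp only [mul_assoc]
      _ = e := by rw [hf, ← hS.idempotents_commute he hf, hu]
  rw [← key he hf heJ, ← hS.idempotents_commute he hf, key hf he hfJ]

/-- In the inverse case `x * x'` and `y * y'` are both the unique recurrent idempotent. -/
theorem exists_mul_eq_of_mem_rightRecurrent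
    (hS : (∀ a b : S, a * b = b * a) ∨ IsInverseSemigroup S) {x y : S}
    (hx : x ∈ rightRecurrent S) (hy : y ∈ rightRecurrent S) : ∃ u, y * u = x := by
  rcases hS with hS | hS
  · obtain ⟨u, hu⟩ := hx y
    exact ⟨x * u, by rw [← mul_assoc, hS y x, hu]⟩
  · obtain ⟨x', ⟨hx1, -⟩, -⟩ := hS x
    obtain ⟨y', ⟨hy1, -⟩, -⟩ := hS y
    have h : x * x' = y * y' := by
      refine hS.eq_of_idempotent_mem_rightRecurrent ?_ ?_ (mul_mem_rightRecurrent_right _ hx)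
        (mul_mem_rightRecurrent_right _ hy)
      · rw [← mul_assoc, hx1]
      · rw [← mul_assoc, hy1]
    exact ⟨y' * x, by rw [← mul_assoc, ← h, hx1]⟩

/-- One `u` undoes `t` at both points: by commutativity, since one is a multiple of the other, or
since both have the same right identity `x' * x = y' * y`. -/
theorem mul_right_injOn_rightRecurrent
    (hS : (∀ a b : S, a * b = b * a) ∨ IsInverseSemigroup S) (t : S) :
    Set.InjOn (· * t) (rightRecurrent S) := by
  intro x hx y hy (hxy : x * t = y * t)
  rcases hS with hS | hS
  · obtain ⟨u, hu⟩ := hx t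
    obtain ⟨v, rfl⟩ := exists_mul_eq_of_mem_rightRecurrent (.inl hS) hy hx
    calc x = x * v * t * u := by rw [← hxy, hu]
      _ = x * t * u * v := by rw [mul_assoc x v t, hS v t, ← mul_assoc, mul_assoc (x * t),
            hS v u, ← mul_assoc]
      _ = x * v := by rw [hu]
  · obtain ⟨x', ⟨hx1, -⟩, -⟩ := hS x
    obtain ⟨y', ⟨hy1, -⟩, -⟩ := hS y
    have h : x' * x = y' * y := by
      refine hS.eq_of_idempotent_mem_rightRecurrent ?_ ?_ (mul_mem_rightRecurrent_left _ hx)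
        (mul_mem_rightRecurrent_left _ hy)
      · rw [mul_assoc, ← mul_assoc x, hx1]
      · rw [mul_assoc, ← mul_assoc y, hy1]
    obtain ⟨u, hu⟩ := mul_mem_rightRecurrent_left x' hx t
    have hx2 : x * t * u = x := by
      conv_rhs => rw [← hx1, mul_assoc, ← hu]
      simp only [← mul_assoc, hx1]
    have hy2 : y * t * u = y := by
      conv_rhs => rw [← hy1, mul_assoc, ← h, ← hu, h]
      simp only [← mul_assoc, hy1]
    rw [← hx2, hxy, hy2]

end Algebra

/-! ### Stationary finitely additive means -/

section StationaryMean

variable {S : Type*} [Monoid S]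

/-- A finitely additive measure of total mass at most `1` which is stationary for the right random
walk with steps uniform on `T`. -/
structure IsStationaryMean (T : Finset S) (m : Set S → ℝ) : Prop where
  nonneg : ∀ A, 0 ≤ m A
  le_one : ∀ A, m A ≤ 1
  union : ∀ A B, Disjoint A B → m (A ∪ B) = m A + m B
  stationary : ∀ A, (T.card : ℝ) * m A = ∑ t ∈ T, m {z | z * t ∈ A}

namespace IsStationaryMean

variable {T : Finset S} {m : Set S → ℝ}

theorem mono (hm : IsStationaryMean T m) {A B : Set S} (h : A ⊆ B) : m A ≤ m B := by
  have := hm.union A (B \ A) Set.disjoint_sdiff_right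
  rw [Set.union_sdiff_cancel h] at this
  linarith [hm.nonneg (B \ A)]

theorem empty (hm : IsStationaryMean T m) : m ∅ = 0 := by
  have := hm.union ∅ ∅ (by simp)
  simp only [Set.union_self] at this
  linarith

theorem finset_eq_sum (hm : IsStationaryMean T m) (F : Finset S) :
    m (F : Set S) = ∑ x ∈ F, m {x} := by
  classical
  induction F using Finset.induction_on with
  | empty => simp [hm.empty]
  | insert a F ha ih =>
    rw [Finset.sum_insert ha, Finset.coe_insert, Set.insert_eq, hm.union, ih]
    simpa using ha

theorem finite_setOf_le (hm : IsStationaryMean T m) {c : ℝ} (hc : 0 < c) :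
    {x | c ≤ m {x}}.Finite := by
  by_contra h
  obtain ⟨n, hn⟩ := exists_nat_gt (1 / c)
  obtain ⟨F, hF, hcard⟩ := Set.Infinite.exists_subset_card_eq h n
  have h1 : (n : ℝ) * c ≤ m (F : Set S) := by
    rw [hm.finset_eq_sum, ← hcard, ← nsmul_eq_mul]
    exact Finset.card_nsmul_le_sum _ _ _ fun x hx => hF hx
  rw [div_lt_iff₀ hc] at hn
  linarith [hm.le_one F]

/-- A closed set is stable under taking preimages, up to null sets. -/
theorem preimage_eq (hm : IsStationaryMean T m) {A : Set S} (hA : ∀ a ∈ A, ∀ s, a * s ∈ A)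
    {t : S} (ht : t ∈ T) : m {z | z * t ∈ A} = m A := by
  have hle : ∀ t ∈ T, m A ≤ m {z | z * t ∈ A} := fun t _ => hm.mono fun a ha => hA a ha t
  have hsum : ∑ t ∈ T, m A = ∑ t ∈ T, m {z | z * t ∈ A} := by
    rw [← hm.stationary, Finset.sum_const, nsmul_eq_mul]
  exact ((Finset.sum_eq_sum_iff_of_le hle).1 hsum t ht).symm

theorem pos_mul (hm : IsStationaryMean T m) {y t : S} (ht : t ∈ T) (hy : 0 < m {y}) :
    0 < m {y * t} := by
  have h1 : m {y} ≤ (T.card : ℝ) * m {y * t} := by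
    rw [hm.stationary]
    refine le_trans (hm.mono ?_)
      (Finset.single_le_sum (f := fun t' => m {z | z * t' ∈ ({y * t} : Set S)})
        (fun _ _ => hm.nonneg _) ht)
    simp
  by_contra h
  have h0 : m {y * t} = 0 := le_antisymm (not_lt.1 h) (hm.nonneg _)
  rw [h0, mul_zero] at h1
  linarith

theorem mem_rightRecurrent (hm : IsStationaryMean T m)
    (hT : Submonoid.closure (T : Set S) = ⊤) {y : S} (hy : 0 < m {y}) :
    y ∈ rightRecurrent S := by
  -- Entering a right ideal `A` from an atom outside it would give the preimage of `A` more mass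
  -- than `A`. Positivity is carried along so that the induction can continue from `y * s`.
  have key : ∀ s : S, ∀ y : S, 0 < m {y} → 0 < m {y * s} ∧
      ∀ A : Set S, (∀ a ∈ A, ∀ s, a * s ∈ A) → y * s ∈ A → y ∈ A := by
    intro s
    have hs : s ∈ Submonoid.closure (T : Set S) := hT ▸ Submonoid.mem_top s
    induction hs using Submonoid.closure_induction with
    | mem t ht =>
      refine fun y hy => ⟨hm.pos_mul ht hy, fun A hA hyt => ?_⟩
      by_contra hyA
      have h1 := hm.preimage_eq hA ht
      have h2 : m (A ∪ {y}) ≤ m {z | z * t ∈ A} := by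
        refine hm.mono (Set.union_subset (fun a ha => hA a ha t) ?_)
        simpa using hyt
      rw [hm.union _ _ (by simpa using hyA)] at h2
      linarith
    | one => exact fun y hy => by simpa using hy
    | mul a b _ _ iha ihb =>
      intro y hy
      obtain ⟨ha1, ha2⟩ := iha y hy
      obtain ⟨hb1, hb2⟩ := ihb _ ha1
      rw [← mul_assoc]
      exact ⟨hb1, fun A hA h => ha2 A hA (hb2 A hA h)⟩
  intro s
  obtain ⟨u, hu⟩ := (key s y hy).2 (Set.range fun u => y * s * u)
    (by rintro _ ⟨u, rfl⟩ v; exact ⟨u * v, (mul_assoc _ _ _).symm⟩) ⟨1, mul_one _⟩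
  exact ⟨u, hu⟩

theorem finite_rightRecurrent (hm : IsStationaryMean T m)
    (hS : (∀ a b : S, a * b = b * a) ∨ IsInverseSemigroup S)
    (hT : Submonoid.closure (T : Set S) = ⊤) {x : S} (hx : 0 < m {x}) :
    (rightRecurrent S).Finite := by
  obtain ⟨y, hy, hmax⟩ := Set.exists_max_image _ (fun z => m {z}) (hm.finite_setOf_le hx)
    ⟨x, by simp⟩
  have hmax' : ∀ z, m {z} ≤ m {y} := fun z => by
    rcases le_total (m {x}) (m {z}) with h | h
    · exact hmax z h
    · exact h.trans hy
  have hy0 : 0 < m {y} := hx.trans_le hy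
  -- Points outside the ideal that a generator sends into it form a null set.
  have hpre : ∀ w ∈ rightRecurrent S, ∀ t ∈ T,
      m {z | z * t = w} = m {z | z ∈ rightRecurrent S ∧ z * t = w} := by
    intro w hw t ht
    refine le_antisymm ?_ (hm.mono fun z hz => hz.2)
    have h1 := hm.preimage_eq (A := rightRecurrent S)
      (fun a ha s => mul_mem_rightRecurrent_right s ha) ht
    have h2 := hm.union (rightRecurrent S) {z | z ∉ rightRecurrent S ∧ z * t = w}
      (Set.disjoint_left.2 fun z hz hz' => hz'.1 hz)
    have h3 : m (rightRecurrent S ∪ {z | z ∉ rightRecurrent S ∧ z * t = w}) ≤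
        m {z | z * t ∈ rightRecurrent S} := by
      refine hm.mono (Set.union_subset
        (fun z hz => mul_mem_rightRecurrent_right t hz) fun z hz => ?_)
      rw [Set.mem_ofPred_eq, hz.2]
      exact hw
    have h4 := hm.union {z | z ∈ rightRecurrent S ∧ z * t = w}
      {z | z ∉ rightRecurrent S ∧ z * t = w} (Set.disjoint_left.2 fun z hz hz' => hz'.1 hz.1)
    have h5 : m {z | z * t = w} ≤ m ({z | z ∈ rightRecurrent S ∧ z * t = w} ∪
      {z | z ∉ rightRecurrent S ∧ z * t = w}) := by
      refine hm.mono fun z hz => ?_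
      by_cases h : z ∈ rightRecurrent S
      · exact .inl ⟨h, hz⟩
      · exact .inr ⟨h, hz⟩
    linarith
  have hfib : ∀ z ∈ rightRecurrent S, ∀ t : S,
      {z' | z' ∈ rightRecurrent S ∧ z' * t = z * t} = {z} := by
    intro z hz t
    ext z'
    exact ⟨fun h => mul_right_injOn_rightRecurrent hS t h.1 hz h.2,
      by rintro rfl; exact ⟨hz, rfl⟩⟩
  -- Maximum principle, run backwards: the mass of `z * t` is an average of terms at most the
  -- maximum, so each term attains it, including the one from `z`.
  have hstep : ∀ s : S, ∀ z ∈ rightRecurrent S, m {z * s} = m {y} → m {z} = m {y} := by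
    intro s
    have hs : s ∈ Submonoid.closure (T : Set S) := hT ▸ Submonoid.mem_top s
    induction hs using Submonoid.closure_induction with
    | mem t ht =>
      intro z hz hzt
      have hle : ∀ t' ∈ T, m {z' | z' * t' = z * t} ≤ m {y} := by
        intro t' ht'
        rw [hpre _ (mul_mem_rightRecurrent_right t hz) t' ht']
        by_cases h : ∃ z' ∈ rightRecurrent S, z' * t' = z * t
        · obtain ⟨z', hz', h⟩ := h
          rw [← h, hfib z' hz']
          exact hmax' z'
        · have : {z' | z' ∈ rightRecurrent S ∧ z' * t' = z * t} = ∅ :=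
            Set.eq_empty_of_forall_notMem fun z' hz' => h ⟨z', hz'⟩
          rw [this, hm.empty]
          exact hy0.le
      have hsum : ∑ t' ∈ T, m {z' | z' * t' = z * t} = ∑ t' ∈ T, m {y} := by
        have := hm.stationary {z * t}
        simp only [Set.mem_singleton_iff] at this
        rw [← this, hzt, Finset.sum_const, nsmul_eq_mul]
      rw [← (Finset.sum_eq_sum_iff_of_le hle).1 hsum t ht,
        hpre _ (mul_mem_rightRecurrent_right t hz) t ht, hfib z hz]
    | one => exact fun z _ h => by simpa using h
    | mul a b _ _ iha ihb =>
      intro z hz h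
      rw [← mul_assoc] at h
      exact iha z hz (ihb _ (mul_mem_rightRecurrent_right a hz) h)
  refine (hm.finite_setOf_le hy0).subset fun z hz => ?_
  obtain ⟨u, hu⟩ := exists_mul_eq_of_mem_rightRecurrent hS (hm.mem_rightRecurrent hT hy0) hz
  exact (hstep u z hz (by rw [hu])).ge

end IsStationaryMean

/-- Cesàro averages of the laws of a chain have a stationary finitely additive limit. -/
theorem exists_isStationaryMean {T : Finset S} (p : ℕ → Set S → ℝ)
    (h0 : ∀ n A, 0 ≤ p n A) (h1 : ∀ n A, p n A ≤ 1)
    (hu : ∀ n A B, Disjoint A B → p n (A ∪ B) = p n A + p n B)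
    (hs : ∀ n A, (T.card : ℝ) * p (n + 1) A = ∑ t ∈ T, p n {z | z * t ∈ A})
    {B : Set S} {c : ℝ} (hB : ∀ n, c ≤ p n B) :
    ∃ m, IsStationaryMean T m ∧ c ≤ m B := by
  let a : ℕ → Set S → ℝ := fun N A => (∑ n ∈ Finset.range (N + 1), p n A) / (N + 1 : ℝ)
  have ha0 : ∀ N A, 0 ≤ a N A := fun N A =>
    div_nonneg (Finset.sum_nonneg fun n _ => h0 n A) (by positivity)
  have ha1 : ∀ N A, a N A ≤ 1 := fun N A => by
    refine (div_le_one (by positivity)).2 ?_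
    refine (Finset.sum_le_card_nsmul _ _ 1 fun n _ => h1 n A).trans ?_
    simp
  have hlim : ∀ A, ∃ x, Filter.Tendsto (fun N => a N A) (Filter.hyperfilter ℕ) (nhds x) := by
    intro A
    obtain ⟨x, -, hx⟩ := (isCompact_Icc (a := (0 : ℝ)) (b := 1)).ultrafilter_le_nhds
      ((Filter.hyperfilter ℕ).map fun N => a N A)
      (by
        rw [Filter.le_principal_iff]
        exact Filter.Eventually.of_forall (f := (Filter.hyperfilter ℕ : Filter ℕ))
          fun N => ⟨ha0 N A, ha1 N A⟩)
    exact ⟨x, hx⟩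
  choose m hm using hlim
  refine ⟨m, ⟨fun A => ge_of_tendsto' (hm A) fun N => ha0 N A,
    fun A => le_of_tendsto' (hm A) fun N => ha1 N A, fun A B hAB => ?_, fun A => ?_⟩, ?_⟩
  · refine tendsto_nhds_unique (hm (A ∪ B)) (((hm A).add (hm B)).congr fun N => ?_)
    simp only [a, hu _ _ _ hAB, Finset.sum_add_distrib, add_div]
  -- The averaged sums telescope, so stationarity fails only by `O(1 / (N + 1))`.
  · have hdiff : ∀ N, (T.card : ℝ) * a N A - ∑ t ∈ T, a N {z | z * t ∈ A} =
        (T.card : ℝ) * (p 0 A - p (N + 1) A) * (1 / ((N : ℝ) + 1)) := by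
      intro N
      have e1 : ∑ t ∈ T, a N {z | z * t ∈ A} =
          ((T.card : ℝ) * ∑ n ∈ Finset.range (N + 1), p (n + 1) A) / (N + 1 : ℝ) := by
        simp only [a]
        rw [← Finset.sum_div, Finset.sum_comm, Finset.mul_sum]
        simp only [hs]
      have e2 := Finset.sum_range_sub (fun n => p n A) (N + 1)
      rw [Finset.sum_sub_distrib] at e2
      have e3 : p 0 A - p (N + 1) A = ∑ n ∈ Finset.range (N + 1), p n A -
          ∑ n ∈ Finset.range (N + 1), p (n + 1) A := by linarith
      rw [e1, e3]
      simp only [a]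
      ring
    have hz : Filter.Tendsto (fun N : ℕ => (T.card : ℝ) * a N A - ∑ t ∈ T, a N {z | z * t ∈ A})
        (Filter.hyperfilter ℕ) (nhds 0) := by
      have hle : (Filter.hyperfilter ℕ : Filter ℕ) ≤ Filter.atTop := Nat.hyperfilter_le_atTop
      have hone := (tendsto_one_div_add_atTop_nhds_zero_nat (𝕜 := ℝ)).mono_left hle
      have hC := hone.const_mul (T.card : ℝ)
      rw [mul_zero] at hC
      refine squeeze_zero_norm (fun N => ?_) hC
      rw [hdiff, norm_mul, norm_mul, Real.norm_natCast,
        Real.norm_of_nonneg (by positivity : (0 : ℝ) ≤ 1 / ((N : ℝ) + 1))]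
      have : ‖p 0 A - p (N + 1) A‖ ≤ 1 := by
        rw [Real.norm_eq_abs, abs_le]
        constructor <;> linarith [h0 0 A, h1 0 A, h0 (N + 1) A, h1 (N + 1) A]
      refine mul_le_mul_of_nonneg_right ?_ (by positivity)
      exact mul_le_of_le_one_right (by positivity) this
    have hl := ((hm A).const_mul (T.card : ℝ)).sub
      (tendsto_finsetSum T fun t _ => hm {z | z * t ∈ A})
    exact sub_eq_zero.1 (tendsto_nhds_unique hl hz)
  · refine ge_of_tendsto' (hm B) fun N => (le_div_iff₀ (by positivity)).2 ?_
    have := Finset.card_nsmul_le_sum (Finset.range (N + 1)) (fun n => p n B) c fun n _ => hB n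
    rw [Finset.card_range, nsmul_eq_mul] at this
    push_cast at this
    linarith

end StationaryMean

/-! ### Uniform steps -/

section UniformStep

variable {S : Type*} [MeasurableSpace S] [DiscreteMeasurableSpace S] {Ω : Type*}
  [MeasurableSpace Ω] {μ : Measure Ω} {T : Finset S}

theorem measureReal_preimage_singleton_of_map_eq_uniformOn {X : Ω → S} (hX : Measurable X)
    (hmap : μ.map X = uniformOn (T : Set S)) {t : S} (ht : t ∈ T) :
    (T.card : ℝ) * μ.real (X ⁻¹' {t}) = 1 := by
  have h : μ (X ⁻¹' {t}) = (T.card : ENNReal)⁻¹ := by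
    rw [← Measure.map_apply hX (measurableSet_singleton t), hmap, uniformOn,
      cond_apply T.measurableSet,
      Set.inter_eq_right.2 (Set.singleton_subset_iff.2 (Finset.mem_coe.2 ht)),
      Measure.count_singleton, mul_one, Measure.count_apply_finset]
  rw [Measure.real, h, ENNReal.toReal_inv, ENNReal.toReal_natCast]
  exact mul_inv_cancel₀ (Nat.cast_ne_zero.2 (Finset.card_ne_zero_of_mem ht))

theorem ae_mem_of_map_eq_uniformOn {X : Ω → S} (hX : Measurable X)
    (hmap : μ.map X = uniformOn (T : Set S)) : ∀ᵐ ω ∂μ, X ω ∈ T := by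
  have h : ∀ᵐ x ∂(μ.map X), x ∈ (T : Set S) := by
    rw [hmap, uniformOn]
    exact ae_cond_mem T.measurableSet
  exact ae_of_ae_map hX.aemeasurable h

end UniformStep

/-! ### Word length and one step of the walk -/

section RandomWalk

variable {S : Type*} [Monoid S]

theorem exists_list_of_closure_eq_top {T : Set S} (hT : Submonoid.closure T = ⊤) (a : S) :
    ∃ l : List S, l.length = wordLength T a ∧ (∀ t ∈ l, t ∈ T) ∧ l.prod = a := by
  obtain ⟨l, hl, hla⟩ := Submonoid.exists_list_of_mem_closure
    (hT ▸ Submonoid.mem_top a : a ∈ Submonoid.closure T)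
  exact Nat.sInf_mem (s := {k : ℕ | ∃ l : List S, l.length = k ∧ (∀ t ∈ l, t ∈ T) ∧ l.prod = a})
    ⟨l.length, l, rfl, hl, hla⟩

theorem wordLength_prod_le {T : Set S} {l : List S} (hl : ∀ t ∈ l, t ∈ T) :
    wordLength T l.prod ≤ l.length :=
  Nat.sInf_le ⟨l, rfl, hl, rfl⟩

theorem finite_setOf_wordLength_le {T : Finset S} (hT : Submonoid.closure (T : Set S) = ⊤)
    (K : ℕ) : {a | wordLength (T : Set S) a ≤ K}.Finite := by
  refine ((List.finite_length_le T K).image fun l => (l.map Subtype.val).prod).subset ?_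
  intro a (ha : _ ≤ K)
  obtain ⟨l, hl, hlT, rfl⟩ := exists_list_of_closure_eq_top hT a
  lift l to List T using hlT
  refine ⟨l, ?_, rfl⟩
  rw [List.length_map] at hl
  exact hl.trans_le ha

theorem countable_of_closure_eq_top {T : Finset S} (hT : Submonoid.closure (T : Set S) = ⊤) :
    Countable S := by
  have hsurj : Function.Surjective fun l : List T => (l.map Subtype.val).prod := by
    intro a
    obtain ⟨l, -, hlT, rfl⟩ := exists_list_of_closure_eq_top hT a
    lift l to List T using hlT
    exact ⟨l, rfl⟩
  exact hsurj.countable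

variable [MeasurableSpace S] [DiscreteMeasurableSpace S] {Ω : Type*} [MeasurableSpace Ω]
  {μ : Measure Ω} {T : Finset S}

theorem indepFun_prod_ofFn [Countable S] {X : ℕ → Ω → S} (hX : ∀ n, Measurable (X n))
    (hind : iIndepFun X μ) (n : ℕ) :
    IndepFun (fun ω => (List.ofFn fun i : Fin n => X i ω).prod) (X n) μ := by
  have h := hind.indepFun_finset (Finset.range n) {n} (by simp) hX
  exact h.comp (φ := fun f => (List.ofFn fun i : Fin n =>
      f ⟨i, Finset.mem_range.2 i.2⟩).prod) (ψ := fun f => f ⟨n, Finset.mem_singleton_self n⟩)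
    (measurable_of_countable _) (measurable_of_countable _)

theorem measureReal_mul_mem [IsProbabilityMeasure μ] {Y X : Ω → S} (hY : Measurable Y) (hX : Measurable X)
    (hind : IndepFun Y X μ) (hmap : μ.map X = uniformOn (T : Set S)) (A : Set S) :
    (T.card : ℝ) * μ.real {ω | Y ω * X ω ∈ A} = ∑ t ∈ T, μ.real (Y ⁻¹' {z | z * t ∈ A}) := by
  have h1 : μ.real {ω | Y ω * X ω ∈ A} =
      μ.real (⋃ t ∈ T, Y ⁻¹' {z | z * t ∈ A} ∩ X ⁻¹' {t}) := by
    refine measureReal_congr ?_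
    filter_upwards [ae_mem_of_map_eq_uniformOn hX hmap] with ω hω
    refine propext ⟨fun h => ?_, fun h => ?_⟩
    · exact Set.mem_biUnion (x := X ω) hω ⟨h, rfl⟩
    · obtain ⟨t, -, h1, h2⟩ := Set.mem_iUnion₂.1 h
      rw [Set.mem_preimage, Set.mem_singleton_iff] at h2
      subst h2
      exact h1
  rw [h1, measureReal_biUnion_finset, Finset.mul_sum]
  · refine Finset.sum_congr rfl fun t ht => ?_
    rw [measureReal_def, hind.measure_inter_preimage_eq_mul _ _ .of_discrete .of_discrete,
      ENNReal.toReal_mul, ← measureReal_def, ← measureReal_def, mul_left_comm,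
      measureReal_preimage_singleton_of_map_eq_uniformOn hX hmap ht, mul_one]
  · intro t _ t' _ hne
    refine Set.disjoint_left.2 fun ω h h' => hne ?_
    exact h.2.symm.trans h'.2
  · exact fun t _ => (hY .of_discrete).inter (hX .of_discrete)

end RandomWalk

/-! ### Conclusion -/

theorem mainTheorem6 {S : Type*} [Monoid S] [MeasurableSpace S] [DiscreteMeasurableSpace S]
    (hS : (∀ a b : S, a * b = b * a) ∨ IsInverseSemigroup S)
    (T : Finset S) (hT : Submonoid.closure (T : Set S) = ⊤)
    {Ω : Type*} [MeasurableSpace Ω] (μ : Measure Ω) [IsProbabilityMeasure μ]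
    (R : ℕ → Ω → S) (hR : IsSimpleRandomWalk T R μ)
    (hbdd : ∃ C : ℝ, ∀ n : ℕ, ∫ ω, (wordLength (T : Set S) (R n ω) : ℝ) ∂μ ≤ C) :
    ∃ I : Set S, IsSemigroupIdeal I ∧ I.Finite := by
  obtain ⟨X, hX, hind, hmap, hRX⟩ := hR
  obtain ⟨C, hC⟩ := hbdd
  have := countable_of_closure_eq_top hT
  have hR' : ∀ n, R n = fun ω => (List.ofFn fun i : Fin n => X i ω).prod :=
    fun n => funext (hRX n)
  have hRm : ∀ n, Measurable (R n) := by
    intro n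
    rw [hR']
    exact (measurable_of_countable fun f : Fin n → S => (List.ofFn f).prod).comp
      (measurable_pi_lambda _ fun i => hX i)
  have hsucc : ∀ n ω, R (n + 1) ω = R n ω * X n ω := by
    intro n ω
    rw [hRX, hRX, List.ofFn_succ', List.concat_eq_append, List.prod_append]
    simp
  -- Needed because the integral of a non-integrable function is 0 by convention, which would make
  -- the bound empty.
  have hint : ∀ n, Integrable (fun ω => (wordLength (T : Set S) (R n ω) : ℝ)) μ := by
    intro n
    refine .of_bound
      ((measurable_of_countable fun a : S => (wordLength (T : Set S) a : ℝ)).comp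
        (hRm n)).aestronglyMeasurable n ?_
    have hall : ∀ᵐ ω ∂μ, ∀ i, X i ω ∈ T :=
      ae_all_iff.2 fun i => ae_mem_of_map_eq_uniformOn (hX i) (hmap i)
    filter_upwards [hall] with ω hω
    rw [Real.norm_natCast, hRX]
    refine Nat.cast_le.2 ((wordLength_prod_le ?_).trans_eq (List.length_ofFn))
    intro t ht
    obtain ⟨i, rfl⟩ := (List.mem_ofFn' _ _).1 ht
    exact hω i
  -- Markov bounds the probability of length at least `K + 1` by `C / (K + 1) < 1/2`.
  obtain ⟨K, hK⟩ := exists_nat_gt (2 * C)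
  have hfin := finite_setOf_wordLength_le hT K
  have hball : ∀ n, 1 / 2 ≤ μ.real (R n ⁻¹' {a | wordLength (T : Set S) a ≤ K}) := by
    intro n
    have hmarkov := mul_meas_ge_le_integral_of_nonneg
      (Filter.Eventually.of_forall fun ω => Nat.cast_nonneg _) (hint n) ((K : ℝ) + 1)
    have hcompl : (R n ⁻¹' {a | wordLength (T : Set S) a ≤ K})ᶜ =
        {ω | (K : ℝ) + 1 ≤ wordLength (T : Set S) (R n ω)} := by
      ext ω
      simp only [Set.mem_compl_iff, Set.mem_preimage, Set.mem_ofPred_eq, not_le]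
      exact_mod_cast Iff.rfl
    rw [← hcompl, probReal_compl_eq_one_sub (hRm n .of_discrete)] at hmarkov
    have hCn := hC n
    have hK0 : (0 : ℝ) ≤ K := Nat.cast_nonneg K
    by_contra! hlt
    nlinarith
  obtain ⟨m, hm, hmB⟩ := exists_isStationaryMean (T := T) (fun n A => μ.real (R n ⁻¹' A))
    (fun _ _ => measureReal_nonneg) (fun _ _ => measureReal_le_one)
    (fun n A B hAB => by
      rw [Set.preimage_union]
      exact measureReal_union (hAB.preimage _) (hRm n .of_discrete))
    (fun n A => by
      have hi : IndepFun (R n) (X n) μ := by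
        rw [hR']
        exact indepFun_prod_ofFn hX hind n
      rw [← measureReal_mul_mem (hRm n) (hX n) hi (hmap n) A]
      simp only [Set.preimage, hsucc])
    hball
  obtain ⟨x, hx⟩ : ∃ x, 0 < m {x} := by
    by_contra! h
    have hsum := hm.finset_eq_sum hfin.toFinset
    rw [hfin.coe_toFinset] at hsum
    linarith [Finset.sum_nonpos fun x (_ : x ∈ hfin.toFinset) => h x]
  exact ⟨rightRecurrent S, ⟨⟨x, hm.mem_rightRecurrent hT hx⟩,
    fun s _ ha => mul_mem_rightRecurrent_left s ha,
    fun s _ ha => mul_mem_rightRecurrent_right s ha⟩, hm.finite_rightRecurrent hS hT hx⟩
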